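/- For a normed space $X$ over $\mathbb{C}$ let $\mathcal{H}_b(X)$ be the space of entire functions $g\colon X\to\mathbb{C}$ of bounded type, that is, $g$ is holomorphic on $X$ and $\lim_{m\to\infty}\big\|\tfrac{1}{m!}\hat d^m g(0)\big\|^{1/m}=0$, where $\|\cdot\|$ is the sup norm of $m$-homogeneous polynomials on the closed unit ball; $\mathcal{H}_b(X)$ carries the locally convex topology generated by the seminorms $\|g\|_\rho=\sum_{m=0}^\infty \rho^m\big\|\tfrac{1}{m!}\hat d^m g(0)\big\|$, $\rho>0$. For a complex Hausdorff locally convex space $E$ and a continuous seminorm $p$ on $E$ let $E_p$ be the normed space $(E,p)/p^{-1}(0)$ and $\pi_p\colon E\to E_p$ the canonical surjection. Let $\mathcal{H}_{ub}(E)=\bigcup_p\{g\circ\pi_p : g\in\mathcal{H}_b(E_p)\}$, the union being over all continuous seminorms $p$ on $E$, endowed with the finest locally convex topology for which all the maps $\mathcal{H}_b(E_p)\to\mathcal{H}_{ub}(E)$, $g\mapsto g\circ\pi_p$, are continuous. Write $(\tau_a f)(x)=f(x-a)$. A convolution operator on $\mathcal{H}_{ub}(E)$ is a continuous linear map $L\colon\mathcal{H}_{ub}(E)\to\mathcal{H}_{ub}(E)$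 such that $L(\tau_b f)=\tau_b(Lf)$ for all $f\in\mathcal{H}_{ub}(E)$ and $b\in E$. A continuous linear operator $T\colon X\to X$ on a topological vector space $X$ is hypercyclic if the orbit $\{x,Tx,T^2x,\dots\}$ is dense in $X$ for some $x\in X$. **Corollary.** Let $\mathbb{C}^{\mathbb{N}}$ carry the product topology. For each $a\in\mathbb{C}^{\mathbb{N}}$, the translation operator $\tau_a$ maps $\mathcal{H}_{ub}(\mathbb{C}^{\mathbb{N}})$ into itself, it is a convolution operator on $\mathcal{H}_{ub}(\mathbb{C}^{\mathbb{N}})$, and it is not hypercyclic. -/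

import Mathlib

open Filter Topology

noncomputable section

namespace BoundedType

/-! ### Entire functions of bounded type on a normed space -/

section Normed

variable {E G : Type*} [NormedAddCommGroup E] [NormedSpace ℂ E]
  [NormedAddCommGroup G] [NormedSpace ℂ G]

/-- The `m`-th Taylor polynomial at the origin, `x ↦ (1 / m!) d̂^m f(0)(x)`. -/
def taylorPoly (f : E → ℂ) (m : ℕ) (x : E) : ℂ :=
  ((m.factorial : ℂ))⁻¹ * iteratedFDeriv ℂ m f 0 (fun _ => x)

/-- The sup norm over the closed unit ball. -/
def polyNorm (P : E → ℂ) : ℝ :=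
  ⨆ x : Metric.closedBall (0 : E) 1, ‖P x‖

/-- `f` is an entire function of bounded type: it is holomorphic on `E`, and the `m`-th roots of
the norms of its Taylor polynomials at the origin tend to `0`. -/
def IsBoundedType (f : E → ℂ) : Prop :=
  AnalyticOnNhd ℂ f Set.univ ∧
    Tendsto (fun m : ℕ => polyNorm (taylorPoly f m) ^ (1 / (m : ℝ))) atTop (𝓝 0)

theorem polyNorm_nonneg (P : E → ℂ) : 0 ≤ polyNorm P :=
  Real.iSup_nonneg fun _ => norm_nonneg _

theorem polyNorm_le {P : E → ℂ} {C : ℝ} (h : ∀ x : E, ‖x‖ ≤ 1 → ‖P x‖ ≤ C) : polyNorm P ≤ C := by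
  have : Nonempty (Metric.closedBall (0 : E) 1) := ⟨⟨0, by simp⟩⟩
  exact ciSup_le fun x => h x (mem_closedBall_zero_iff.1 x.2)

theorem norm_taylorPoly_le (f : E → ℂ) (m : ℕ) {x : E} (hx : ‖x‖ ≤ 1) :
    ‖taylorPoly f m x‖ ≤ polyNorm (taylorPoly f m) := by
  have hb : BddAbove (Set.range fun x : Metric.closedBall (0 : E) 1 => ‖taylorPoly f m x‖) := by
    refine ⟨‖((m.factorial : ℂ))⁻¹‖ * ‖iteratedFDeriv ℂ m f 0‖, ?_⟩
    rintro _ ⟨y, rfl⟩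
    have hy : ‖(y : E)‖ ≤ 1 := mem_closedBall_zero_iff.1 y.2
    simp only [taylorPoly, norm_mul]
    gcongr
    refine (ContinuousMultilinearMap.le_opNorm _ _).trans ?_
    simp only [Finset.prod_const, Finset.card_univ, Fintype.card_fin]
    exact mul_le_of_le_one_right (norm_nonneg _) (pow_le_one₀ (norm_nonneg _) hy)
  exact le_ciSup hb ⟨x, by simpa using hx⟩

theorem tendsto_root_iff_summable {u : ℕ → ℝ} (hu : ∀ m, 0 ≤ u m) :
    Tendsto (fun m : ℕ => u m ^ (1 / (m : ℝ))) atTop (𝓝 0) ↔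
      ∀ ρ : ℝ, 0 < ρ → Summable fun m : ℕ => ρ ^ m * u m := by
  constructor
  · intro h ρ hρ
    have hev : ∀ᶠ m : ℕ in atTop, u m ^ (1 / (m : ℝ)) < (2 * ρ)⁻¹ :=
      h.eventually (gt_mem_nhds (by positivity))
    refine Summable.of_norm_bounded_eventually_nat (g := fun m : ℕ => (1 / 2 : ℝ) ^ m)
      (summable_geometric_of_lt_one (by norm_num) (by norm_num)) ?_
    filter_upwards [hev, eventually_ge_atTop 1] with m hm h1
    have hm0 : m ≠ 0 := by omega
    have key : u m ≤ ((2 * ρ)⁻¹) ^ m := by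
      calc u m = (u m ^ (1 / (m : ℝ))) ^ m := by
            rw [one_div, Real.rpow_inv_natCast_pow (hu m) hm0]
        _ ≤ _ := pow_le_pow_left₀ (Real.rpow_nonneg (hu m) _) hm.le m
    rw [Real.norm_of_nonneg (mul_nonneg (pow_nonneg hρ.le m) (hu m))]
    calc ρ ^ m * u m ≤ ρ ^ m * ((2 * ρ)⁻¹) ^ m := by gcongr
      _ = (1 / 2) ^ m := by rw [← mul_pow]; congr 1; field_simp
  · intro h
    rw [tendsto_order]
    constructor
    · intro a ha
      exact Eventually.of_forall fun m => ha.trans_le (Real.rpow_nonneg (hu m) _)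
    · intro ε hε
      have h0 := (h (2 / ε) (by positivity)).tendsto_atTop_zero
      filter_upwards [h0.eventually (gt_mem_nhds one_pos), eventually_ge_atTop 1] with m hm h1
      have hm0 : m ≠ 0 := by omega
      have hpos : (0 : ℝ) < (2 / ε) ^ m := by positivity
      have key : u m ≤ (ε / 2) ^ m := by
        have : u m < 1 / (2 / ε) ^ m := by
          rw [lt_div_iff₀ hpos]; linarith [mul_comm (u m) ((2 / ε) ^ m)]
        refine this.le.trans (le_of_eq ?_)
        rw [← one_div_pow, one_div_div]
      calc u m ^ (1 / (m : ℝ)) ≤ ((ε / 2) ^ m) ^ (1 / (m : ℝ)) :=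
            Real.rpow_le_rpow (hu m) key (by positivity)
        _ = ε / 2 := by rw [one_div, Real.pow_rpow_inv_natCast (by positivity) hm0]
        _ < ε := by linarith

theorem isBoundedType_iff {f : E → ℂ} :
    IsBoundedType f ↔ AnalyticOnNhd ℂ f Set.univ ∧
      ∀ ρ : ℝ, 0 < ρ → Summable fun m : ℕ => ρ ^ m * polyNorm (taylorPoly f m) :=
  and_congr_right fun _ => tendsto_root_iff_summable fun _ => polyNorm_nonneg _

theorem contDiffAt_of_analytic {f : E → ℂ} (hf : AnalyticOnNhd ℂ f Set.univ) (m : ℕ) (x : E) :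
    ContDiffAt ℂ m f x :=
  (hf x (Set.mem_univ x)).contDiffAt

theorem polyNorm_taylorPoly_add {f g : E → ℂ} (hf : AnalyticOnNhd ℂ f Set.univ)
    (hg : AnalyticOnNhd ℂ g Set.univ) (m : ℕ) :
    polyNorm (taylorPoly (f + g) m) ≤ polyNorm (taylorPoly f m) + polyNorm (taylorPoly g m) := by
  refine polyNorm_le fun x hx => ?_
  have : taylorPoly (f + g) m x = taylorPoly f m x + taylorPoly g m x := by
    simp only [taylorPoly]
    rw [iteratedFDeriv_add_apply (contDiffAt_of_analytic hf m 0) (contDiffAt_of_analytic hg m 0)]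
    simp [mul_add]
  rw [this]
  exact (norm_add_le _ _).trans
    (add_le_add (norm_taylorPoly_le f m hx) (norm_taylorPoly_le g m hx))

theorem polyNorm_taylorPoly_smul {f : E → ℂ} (hf : AnalyticOnNhd ℂ f Set.univ) (c : ℂ) (m : ℕ) :
    polyNorm (taylorPoly (c • f) m) = ‖c‖ * polyNorm (taylorPoly f m) := by
  have : ∀ x, taylorPoly (c • f) m x = c * taylorPoly f m x := fun x => by
    simp only [taylorPoly]
    rw [iteratedFDeriv_const_smul_apply (contDiffAt_of_analytic hf m 0)]
    simp only [smul_apply, smul_eq_mul]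
    ring
  simp only [polyNorm, this, norm_mul]
  exact (Real.mul_iSup_of_nonneg (norm_nonneg c) _).symm

theorem taylorPoly_zero (m : ℕ) : taylorPoly (0 : E → ℂ) m = 0 := by
  funext x
  have h : iteratedFDeriv ℂ m (0 : E → ℂ) 0 = 0 := by simp
  simp [taylorPoly, h]

theorem polyNorm_zero : polyNorm (0 : E → ℂ) = 0 := by simp [polyNorm]

variable (E) in
/-- The entire functions of bounded type on `E`, as a space of functions. -/
def hbSubmodule : Submodule ℂ (E → ℂ) where
  carrier := {f | IsBoundedType f}
  zero_mem' := isBoundedType_iff.2 ⟨analyticOnNhd_const, fun ρ _ => by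
    simp [taylorPoly_zero, polyNorm_zero]⟩
  add_mem' := by
    intro f g hf hg
    obtain ⟨hf, hf'⟩ := isBoundedType_iff.1 hf
    obtain ⟨hg, hg'⟩ := isBoundedType_iff.1 hg
    refine isBoundedType_iff.2 ⟨hf.add hg, fun ρ hρ => ?_⟩
    refine Summable.of_nonneg_of_le
      (fun m => mul_nonneg (pow_nonneg hρ.le m) (polyNorm_nonneg _)) (fun m => ?_)
      ((hf' ρ hρ).add (hg' ρ hρ))
    rw [← mul_add]
    exact mul_le_mul_of_nonneg_left (polyNorm_taylorPoly_add hf hg m) (pow_nonneg hρ.le m)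
  smul_mem' := by
    intro c f hf
    obtain ⟨hf, hf'⟩ := isBoundedType_iff.1 hf
    refine isBoundedType_iff.2 ⟨(analyticOnNhd_const (v := c)).smul hf, fun ρ hρ => ?_⟩
    have := (hf' ρ hρ).mul_left ‖c‖
    refine this.congr fun m => ?_
    rw [polyNorm_taylorPoly_smul hf]
    ring

variable (E) in
/-- The space `H_b(E)` of entire functions of bounded type on the normed space `E`. -/
def Hb : Type _ := hbSubmodule E

instance : AddCommGroup (Hb E) := inferInstanceAs (AddCommGroup (hbSubmodule E))

instance : Module ℂ (Hb E) := inferInstanceAs (Module ℂ (hbSubmodule E))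

instance : CoeFun (Hb E) fun _ => E → ℂ := ⟨fun f => f.1⟩

/-- The seminorm `‖f‖_ρ = ∑ₘ ρ^m ‖(1 / m!) d̂^m f(0)‖` on `H_b(E)`, for `ρ > 0`. -/
def hbSeminorm (ρ : {ρ : ℝ // 0 < ρ}) : Seminorm ℂ (Hb E) :=
  Seminorm.of (fun f => ∑' m : ℕ, (ρ : ℝ) ^ m * polyNorm (taylorPoly (f : E → ℂ) m))
    (fun f g => by
      obtain ⟨hf, hf'⟩ := isBoundedType_iff.1 f.2
      obtain ⟨hg, hg'⟩ := isBoundedType_iff.1 g.2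
      have hs := isBoundedType_iff.1 (f + g).2
      rw [← (hf' ρ ρ.2).tsum_add (hg' ρ ρ.2)]
      refine (hs.2 ρ ρ.2).tsum_le_tsum (fun m => ?_) ((hf' ρ ρ.2).add (hg' ρ ρ.2))
      rw [← mul_add]
      exact mul_le_mul_of_nonneg_left (polyNorm_taylorPoly_add hf hg m) (pow_nonneg ρ.2.le m))
    (fun c f => by
      rw [← tsum_mul_left]
      refine tsum_congr fun m => ?_
      have h : polyNorm (taylorPoly ((c • f : Hb E) : E → ℂ) m) =
          ‖c‖ * polyNorm (taylorPoly (f : E → ℂ) m) :=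
        polyNorm_taylorPoly_smul (isBoundedType_iff.1 f.2).1 c m
      rw [h]
      ring)

/-- `H_b(E)` carries the locally convex topology generated by the seminorms `‖·‖_ρ`, `ρ > 0`. -/
instance : TopologicalSpace (Hb E) :=
  haveI : Nonempty {ρ : ℝ // 0 < ρ} := ⟨⟨1, one_pos⟩⟩
  SeminormFamily.moduleFilterBasis (𝕜 := ℂ) (fun ρ => hbSeminorm (E := E) ρ) |>.topology

/-- Functions of bounded type pull back along linear maps of norm at most one. -/
theorem IsBoundedType.comp {f : E → ℂ} (hf : IsBoundedType f) (T : G →L[ℂ] E)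
    (hT : ∀ x, ‖T x‖ ≤ ‖x‖) : IsBoundedType (f ∘ T) := by
  obtain ⟨hf, hf'⟩ := isBoundedType_iff.1 hf
  refine isBoundedType_iff.2 ⟨?_, fun ρ hρ => ?_⟩
  · exact AnalyticOnNhd.compContinuousLinearMap (s := Set.univ) hf
  · refine Summable.of_nonneg_of_le
      (fun m => mul_nonneg (pow_nonneg hρ.le m) (polyNorm_nonneg _)) (fun m => ?_) (hf' ρ hρ)
    refine mul_le_mul_of_nonneg_left (polyNorm_le fun x hx => ?_) (pow_nonneg hρ.le m)
    have hc : ContDiff ℂ m f := contDiff_iff_contDiffAt.2 (contDiffAt_of_analytic hf m)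
    have : taylorPoly (f ∘ T) m x = taylorPoly f m (T x) := by
      simp only [taylorPoly]
      rw [T.iteratedFDeriv_comp_right hc 0 le_rfl]
      simp
    rw [this]
    exact norm_taylorPoly_le f m ((hT x).trans hx)

end Normed

/-! ### Entire functions of uniform bounded type on a locally convex space -/

section LocallyConvex

variable {E : Type*} [AddCommGroup E] [Module ℂ E]

/-- The space `E` equipped with the seminorm `p`. -/
def Seminormed (_p : Seminorm ℂ E) : Type _ := E

instance (p : Seminorm ℂ E) : SeminormedAddCommGroup (Seminormed p) :=
  p.toAddGroupSeminorm.toSeminormedAddCommGroup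

instance (p : Seminorm ℂ E) : Module ℂ (Seminormed p) := inferInstanceAs (Module ℂ E)

instance (p : Seminorm ℂ E) : NormedSpace ℂ (Seminormed p) where
  norm_smul_le c x := (map_smul_eq_mul p c (x : E)).le

/-- The normed space `E_p = (E, p) / p⁻¹(0)`. -/
abbrev Quot (p : Seminorm ℂ E) : Type _ := SeparationQuotient (Seminormed p)

/-- The canonical surjection `π_p : E → E_p`. -/
def toQuot (p : Seminorm ℂ E) : E →ₗ[ℂ] Quot p where
  toFun x := SeparationQuotient.mk (X := Seminormed p) x
  map_add' _ _ := rfl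
  map_smul' _ _ := rfl

theorem norm_toQuot (p : Seminorm ℂ E) (x : E) : ‖toQuot p x‖ = p x :=
  SeparationQuotient.norm_mk (E := Seminormed p) x

theorem toQuot_surjective (p : Seminorm ℂ E) : Function.Surjective (toQuot p) :=
  SeparationQuotient.surjective_mk (X := Seminormed p)

theorem exists_quotMap {p q : Seminorm ℂ E} (h : p ≤ q) :
    ∃ T : Quot q →L[ℂ] Quot p, (∀ x, T (toQuot q x) = toQuot p x) ∧ ∀ y, ‖T y‖ ≤ ‖y‖ := by
  let S : Seminormed q →ₗ[ℂ] Quot p :=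
    { toFun := fun x => toQuot p x
      map_add' := fun x y => map_add (toQuot p) x y
      map_smul' := fun c x => map_smul (toQuot p) c x }
  have hS : ∀ x : Seminormed q, ‖S x‖ ≤ ‖x‖ := fun x => (norm_toQuot p x).le.trans (h x)
  let S' : Seminormed q →L[ℂ] Quot p := S.mkContinuous 1 fun x => by simpa using hS x
  refine ⟨SeparationQuotient.liftCLM S' fun x y hxy =>
    (hxy.map S'.continuous).eq, fun x => rfl, fun y => ?_⟩
  obtain ⟨x, rfl⟩ := SeparationQuotient.surjective_mk y
  rw [SeparationQuotient.norm_mk]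
  exact hS x

/-- `f : E → ℂ` is of uniform bounded type: `f = f_p ∘ π_p` for some continuous seminorm `p` on `E`
and some `f_p ∈ H_b(E_p)`. Such an `f` is automatically holomorphic. -/
def IsUniformBoundedType [TopologicalSpace E] (f : E → ℂ) : Prop :=
  ∃ p : Seminorm ℂ E, Continuous p ∧ ∃ g : Hb (Quot p), f = (g : Quot p → ℂ) ∘ toQuot p

variable [TopologicalSpace E]

variable (E) in
/-- The functions of uniform bounded type on `E`, as a space of functions. -/
def hubSubmodule : Submodule ℂ (E → ℂ) where
  carrier := {f | IsUniformBoundedType f}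
  zero_mem' := ⟨0, continuous_const, 0, rfl⟩
  add_mem' := by
    rintro _ _ ⟨p, hp, f, rfl⟩ ⟨q, hq, g, rfl⟩
    obtain ⟨S, hS, hS'⟩ := exists_quotMap (le_sup_left : p ≤ p ⊔ q)
    obtain ⟨T, hT, hT'⟩ := exists_quotMap (le_sup_right : q ≤ p ⊔ q)
    refine ⟨p ⊔ q, ?_, ⟨_, (hbSubmodule _).add_mem (f.2.comp S hS') (g.2.comp T hT')⟩, ?_⟩
    · have : ⇑(p ⊔ q) = fun x => max (p x) (q x) := rfl
      rw [this]
      exact hp.max hq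
    · funext x
      simp [hS, hT]
  smul_mem' := by
    rintro c _ ⟨p, hp, f, rfl⟩
    exact ⟨p, hp, c • f, rfl⟩

variable (E) in
/-- The space `H_ub(E)` of entire functions of uniform bounded type on the locally convex
space `E`. -/
def Hub : Type _ := hubSubmodule E

instance : AddCommGroup (Hub E) := inferInstanceAs (AddCommGroup (hubSubmodule E))

instance : Module ℂ (Hub E) := inferInstanceAs (Module ℂ (hubSubmodule E))

instance : CoeFun (Hub E) fun _ => E → ℂ := ⟨fun f => f.1⟩

/-- The injective linear map `π_p^* : H_b(E_p) → H_ub(E)`, `g ↦ g ∘ π_p`. -/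
def pullback (p : Seminorm ℂ E) (hp : Continuous p) : Hb (Quot p) →ₗ[ℂ] Hub E where
  toFun g := ⟨(g : Quot p → ℂ) ∘ toQuot p, p, hp, g, rfl⟩
  map_add' _ _ := rfl
  map_smul' _ _ := rfl

/-- `H_ub(E)` carries the locally convex inductive topology with respect to the maps `π_p^*`: the
finest locally convex vector space topology for which all of them are continuous. -/
instance : TopologicalSpace (Hub E) :=
  sInf {t | @IsTopologicalAddGroup (Hub E) t _ ∧ @ContinuousSMul ℂ (Hub E) _ _ t ∧
    @LocallyConvexSpace ℝ (Hub E) _ _ _ _ t ∧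
    ∀ (p : Seminorm ℂ E) (hp : Continuous p), Continuous[inferInstance, t] (pullback p hp)}

/-- The translate `(τ_a f)(x) = f (x - a)`. -/
def translate (a : E) (f : E → ℂ) : E → ℂ := fun x => f (x - a)

/-- A convolution operator on `H_ub(E)` is a continuous linear operator `L` on `H_ub(E)` with
`L (τ_a f) = τ_a (L f)` for all `f ∈ H_ub(E)` and `a ∈ E`; that `τ_a f` is again in `H_ub(E)` is
part of the condition. -/
def IsConvolutionOperator (L : Hub E →L[ℂ] Hub E) : Prop :=
  ∀ (f : Hub E) (a : E), ∃ h : IsUniformBoundedType (translate a (f : E → ℂ)),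
    (L ⟨translate a (f : E → ℂ), h⟩ : E → ℂ) = translate a (L f : E → ℂ)

end LocallyConvex

/-- A continuous linear operator `T` on `X` is hypercyclic if for some `x` the orbit
`{x, T x, T² x, …}` is dense in `X`. -/
def IsHypercyclic {X : Type*} [AddCommGroup X] [Module ℂ X] [TopologicalSpace X]
    (T : X →L[ℂ] X) : Prop :=
  ∃ x : X, Dense (Set.range fun n : ℕ => T^[n] x)

end BoundedType

end

/-!
Everything takes place in `H_ub(E)`, whose topology is final, among locally convex ones, with
respect to the maps `π_p^* : H_b(E_p) → H_ub(E)`. A linear map from `H_ub(E)` to a locally convex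
space is therefore continuous as soon as its composition with every `π_p^*` is
(`continuous_of_comp_pullback`).

*Translations are continuous operators, on every `E`.* Restricting a function to complex lines
reduces two estimates on a normed space to functions of one variable: summing the Taylor series
gives `‖g x‖ ≤ ‖g‖_ρ` whenever `‖x‖ ≤ ρ` (`norm_le_hbSeminorm`), and Cauchy's inequality bounds the
`m`-th Taylor polynomial by `M / r ^ m` if `‖g‖ ≤ M` on the ball of radius `r`
(`polyNorm_taylorPoly_le`). Together they give `‖τ_b g‖_ρ ≤ 2 ‖g‖_{2ρ + ‖b‖}`, so that `τ_b` is a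
continuous operator on `H_b(E_p)` (`hbTranslate`). As `τ_a ∘ π_p^* = π_p^* ∘ τ_{π_p a}`, the
operator `τ_a` on `H_ub(E)` is continuous as well (`hubTranslate`).

*No translation of `H_ub(ℂ^ℕ)` is hypercyclic.* A continuous seminorm on `ℂ^ℕ` kills some basis
vector `e_i` (`exists_seminorm_single_eq_zero`), because a neighbourhood of `0` restricts only
finitely many coordinates. So a function of uniform bounded type `f` satisfies
`f (x + e_i) = f x` for some `i` and all `x`, and so do all its translates. The whole orbit of `f`
thus lies in the kernel of the functional `h ↦ h e_i - h 0`, which is continuous since point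
evaluations are, and which is nonzero since it takes the value `1` at the `i`-th coordinate.
-/

noncomputable section

namespace BoundedType

section Normed

variable {E : Type*} [NormedAddCommGroup E] [NormedSpace ℂ E]

/-! ### Taylor polynomials along complex lines -/

theorem taylorPoly_eq_iteratedDeriv {f : E → ℂ} (hf : AnalyticOnNhd ℂ f Set.univ) (m : ℕ) (x : E) :
    taylorPoly f m x =
      ((m.factorial : ℂ))⁻¹ * iteratedDeriv m (fun t : ℂ => f (t • x)) 0 := by
  have hc : ContDiff ℂ m f := contDiff_iff_contDiffAt.2 (contDiffAt_of_analytic hf m)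
  have h := (ContinuousLinearMap.toSpanSingleton ℂ x).iteratedFDeriv_comp_right hc 0 le_rfl
  have hfun : (fun t : ℂ => f (t • x)) = f ∘ ContinuousLinearMap.toSpanSingleton ℂ x := by
    funext t
    simp
  rw [taylorPoly, iteratedDeriv_eq_iteratedFDeriv, hfun, h]
  simp

theorem differentiable_line {f : E → ℂ} (hf : AnalyticOnNhd ℂ f Set.univ) (x : E) :
    Differentiable ℂ fun t : ℂ => f (t • x) := by
  have hd : Differentiable ℂ f := fun y => (hf y (Set.mem_univ y)).differentiableAt
  exact hd.comp (differentiable_id.smul_const x)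

/-- An entire function is the sum of its Taylor series, on the whole space. -/
theorem hasSum_taylorPoly {f : E → ℂ} (hf : AnalyticOnNhd ℂ f Set.univ) (x : E) :
    HasSum (fun m => taylorPoly f m x) (f x) := by
  have h := Complex.hasSum_taylorSeries_of_entire (differentiable_line hf x) 0 1
  simpa [taylorPoly_eq_iteratedDeriv hf] using h

theorem taylorPoly_smul (f : E → ℂ) (m : ℕ) (c : ℂ) (x : E) :
    taylorPoly f m (c • x) = c ^ m * taylorPoly f m x := by
  have h := (iteratedFDeriv ℂ m f 0).map_smul_univ (fun _ => c) (fun _ => x)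
  simp only [taylorPoly, h, Finset.prod_const, Finset.card_univ, Fintype.card_fin, smul_eq_mul]
  ring

theorem norm_taylorPoly_le_pow (f : E → ℂ) (m : ℕ) {ρ : ℝ} (hρ : 0 < ρ) {x : E} (hx : ‖x‖ ≤ ρ) :
    ‖taylorPoly f m x‖ ≤ ρ ^ m * polyNorm (taylorPoly f m) := by
  have hρ' : (ρ : ℂ) ≠ 0 := by exact_mod_cast hρ.ne'
  have hx' : ‖(ρ : ℂ)⁻¹ • x‖ ≤ 1 := by
    rw [norm_smul, norm_inv, Complex.norm_of_nonneg hρ.le, inv_mul_le_iff₀ hρ]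
    simpa using hx
  calc ‖taylorPoly f m x‖ = ‖taylorPoly f m ((ρ : ℂ) • (ρ : ℂ)⁻¹ • x)‖ := by
        rw [smul_inv_smul₀ hρ']
    _ = ρ ^ m * ‖taylorPoly f m ((ρ : ℂ)⁻¹ • x)‖ := by
        rw [taylorPoly_smul, norm_mul, norm_pow, Complex.norm_of_nonneg hρ.le]
    _ ≤ _ := mul_le_mul_of_nonneg_left (norm_taylorPoly_le f m hx') (pow_nonneg hρ.le m)

theorem norm_le_hbSeminorm (g : Hb E) (ρ : {ρ : ℝ // 0 < ρ}) {x : E} (hx : ‖x‖ ≤ ρ) :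
    ‖(g : E → ℂ) x‖ ≤ hbSeminorm ρ g := by
  obtain ⟨hg, hs⟩ := isBoundedType_iff.1 g.2
  rw [← (hasSum_taylorPoly hg x).tsum_eq]
  exact tsum_of_norm_bounded (hs ρ ρ.2).hasSum fun m => norm_taylorPoly_le_pow _ m ρ.2 hx

/-- Cauchy's inequality for the Taylor polynomials at the origin. -/
theorem polyNorm_taylorPoly_le {f : E → ℂ} (hf : AnalyticOnNhd ℂ f Set.univ) {r M : ℝ}
    (hr : 0 < r) (hM : ∀ x, ‖x‖ ≤ r → ‖f x‖ ≤ M) (m : ℕ) :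
    polyNorm (taylorPoly f m) ≤ M / r ^ m := by
  refine polyNorm_le fun x hx => ?_
  have hC := Complex.norm_iteratedDeriv_le_of_forall_mem_sphere_norm_le m hr
    (differentiable_line hf x).diffContOnCl (c := 0) (C := M) fun t ht => hM _ <| by
      rw [norm_smul, mem_sphere_zero_iff_norm.1 ht]
      exact mul_le_of_le_one_right hr.le hx
  have hm : (0 : ℝ) < m.factorial := by exact_mod_cast m.factorial_pos
  rw [taylorPoly_eq_iteratedDeriv hf, norm_mul, norm_inv, Complex.norm_natCast,
    inv_mul_le_iff₀ hm, ← mul_div_assoc]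
  exact hC

/-- The radius `2ρ` in Cauchy's inequality makes the series of `‖f‖_ρ` geometric of ratio
`1 / 2`. -/
theorem pow_mul_polyNorm_le {f : E → ℂ} (hf : AnalyticOnNhd ℂ f Set.univ) {ρ M : ℝ}
    (hρ : 0 < ρ) (hM : ∀ x, ‖x‖ ≤ 2 * ρ → ‖f x‖ ≤ M) (m : ℕ) :
    ρ ^ m * polyNorm (taylorPoly f m) ≤ M * (1 / 2) ^ m := by
  refine (mul_le_mul_of_nonneg_left (polyNorm_taylorPoly_le hf (by positivity) hM m)
    (pow_nonneg hρ.le m)).trans (le_of_eq ?_)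
  rw [mul_pow, one_div, inv_pow]
  field_simp

theorem isBoundedType_of_bounded {f : E → ℂ} (hf : AnalyticOnNhd ℂ f Set.univ)
    (hb : ∀ r : ℝ, ∃ M, ∀ x, ‖x‖ ≤ r → ‖f x‖ ≤ M) : IsBoundedType f := by
  refine isBoundedType_iff.2 ⟨hf, fun ρ hρ => ?_⟩
  obtain ⟨M, hM⟩ := hb (2 * ρ)
  exact Summable.of_nonneg_of_le (fun m => mul_nonneg (pow_nonneg hρ.le m) (polyNorm_nonneg _))
    (pow_mul_polyNorm_le hf hρ hM) (summable_geometric_two.mul_left M)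

theorem hbSeminorm_le (g : Hb E) (ρ : {ρ : ℝ // 0 < ρ}) {M : ℝ}
    (hM : ∀ x, ‖x‖ ≤ 2 * (ρ : ℝ) → ‖(g : E → ℂ) x‖ ≤ M) : hbSeminorm ρ g ≤ 2 * M := by
  obtain ⟨hg, hs⟩ := isBoundedType_iff.1 g.2
  calc hbSeminorm ρ g ≤ ∑' m : ℕ, M * (1 / 2) ^ m :=
        (hs ρ ρ.2).tsum_le_tsum (pow_mul_polyNorm_le hg ρ.2 hM) (summable_geometric_two.mul_left M)
    _ = 2 * M := by rw [tsum_mul_left, tsum_geometric_two, mul_comm]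

theorem isBoundedType_continuousLinearMap (φ : E →L[ℂ] ℂ) : IsBoundedType φ :=
  isBoundedType_of_bounded (fun x _ => φ.analyticAt x) fun r => ⟨‖φ‖ * r, fun x hx =>
    (φ.le_opNorm x).trans (mul_le_mul_of_nonneg_left hx (norm_nonneg φ))⟩

/-! ### Evaluations and translations on `H_b` -/

theorem withSeminorms_hbSeminorm : WithSeminorms (hbSeminorm (E := E)) := ⟨rfl⟩

theorem continuous_hb_eval (x : E) : Continuous fun g : Hb E => (g : E → ℂ) x := by
  let φ : Hb E →ₗ[ℂ] ℂ :=
    { toFun := fun g => (g : E → ℂ) x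
      map_add' := fun _ _ => rfl
      map_smul' := fun _ _ => rfl }
  refine withSeminorms_hbSeminorm.continuous_normedSpace_rng ℂ φ
    ⟨{⟨‖x‖ + 1, by positivity⟩}, 1, fun g => ?_⟩
  rw [Finset.sup_singleton, one_smul]
  exact norm_le_hbSeminorm g _ (by simp)

theorem IsBoundedType.translate {g : E → ℂ} (hg : IsBoundedType g) (b : E) :
    IsBoundedType (translate b g) := by
  refine isBoundedType_of_bounded (fun x _ => ?_) fun r => ?_
  · exact AnalyticAt.comp (g := g) (f := fun y => y - b) (hg.1 (x - b) (Set.mem_univ _))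
      (analyticAt_id.sub analyticAt_const)
  · have hpos : 0 < |r| + ‖b‖ + 1 := by positivity
    refine ⟨hbSeminorm ⟨_, hpos⟩ (⟨g, hg⟩ : Hb E), fun x hx => ?_⟩
    refine norm_le_hbSeminorm (⟨g, hg⟩ : Hb E) ⟨_, hpos⟩ ((norm_sub_le x b).trans ?_)
    change ‖x‖ + ‖b‖ ≤ |r| + ‖b‖ + 1
    linarith [le_abs_self r]

/-- Translation by `b` as a linear operator on `H_b(E)`. -/
def hbTranslate (b : E) : Hb E →ₗ[ℂ] Hb E where
  toFun g := ⟨translate b (g : E → ℂ), IsBoundedType.translate g.2 b⟩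
  map_add' _ _ := rfl
  map_smul' _ _ := rfl

theorem hbSeminorm_hbTranslate_le (b : E) (ρ : {ρ : ℝ // 0 < ρ}) (g : Hb E) :
    hbSeminorm ρ (hbTranslate b g) ≤
      2 * hbSeminorm ⟨2 * ρ + ‖b‖, add_pos_of_pos_of_nonneg (mul_pos two_pos ρ.2)
        (norm_nonneg b)⟩ g :=
  hbSeminorm_le _ ρ fun x hx =>
    norm_le_hbSeminorm g _ ((norm_sub_le x b).trans (add_le_add_left hx ‖b‖))

theorem continuous_hbTranslate (b : E) : Continuous (hbTranslate b) := by
  refine withSeminorms_hbSeminorm.continuous_of_isBounded withSeminorms_hbSeminorm _ fun ρ =>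
    ⟨{⟨2 * ρ + ‖b‖, add_pos_of_pos_of_nonneg (mul_pos two_pos ρ.2) (norm_nonneg b)⟩}, 2,
      fun g => ?_⟩
  rw [Finset.sup_singleton]
  exact hbSeminorm_hbTranslate_le b ρ g

end Normed

section LocallyConvex

variable {E : Type*} [AddCommGroup E] [Module ℂ E] [TopologicalSpace E]

/-! ### The inductive topology of `H_ub` -/

/-- The defining conditions on the locally convex topologies whose infimum is the topology
of `H_ub(E)`. -/
def IsAdmissible (t : TopologicalSpace (Hub E)) : Prop :=
  @IsTopologicalAddGroup (Hub E) t _ ∧ @ContinuousSMul ℂ (Hub E) _ _ t ∧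
    @LocallyConvexSpace ℝ (Hub E) _ _ _ _ t ∧
    ∀ (p : Seminorm ℂ E) (hp : Continuous p), Continuous[inferInstance, t] (pullback p hp)

/-- The infimum is itself attained: the topology of `H_ub(E)` is a locally convex vector space
topology for which all the maps `π_p^*` are continuous. -/
theorem isAdmissible_hub : IsAdmissible (inferInstance : TopologicalSpace (Hub E)) :=
  ⟨topologicalAddGroup_sInf fun _ h => h.1, continuousSMul_sInf fun _ h => h.2.1,
    LocallyConvexSpace.sInf fun _ h => h.2.2.1,
    fun p hp => continuous_sInf_rng.2 fun _ h => h.2.2.2 p hp⟩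

instance : IsTopologicalAddGroup (Hub E) := isAdmissible_hub.1

instance : ContinuousSMul ℂ (Hub E) := isAdmissible_hub.2.1

instance : LocallyConvexSpace ℝ (Hub E) := isAdmissible_hub.2.2.1

theorem continuous_pullback (p : Seminorm ℂ E) (hp : Continuous p) : Continuous (pullback p hp) :=
  isAdmissible_hub.2.2.2 p hp

/-- The universal property of `H_ub(E)`: the topology induced by `L` is one of those whose infimum
is taken. -/
theorem continuous_of_comp_pullback {F : Type*} [AddCommGroup F] [Module ℂ F] [TopologicalSpace F]
    [IsTopologicalAddGroup F] [ContinuousSMul ℂ F] [LocallyConvexSpace ℝ F] (L : Hub E →ₗ[ℂ] F)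
    (h : ∀ (p : Seminorm ℂ E) (hp : Continuous p), Continuous fun g => L (pullback p hp g)) :
    Continuous L := by
  rw [continuous_iff_le_induced]
  exact sInf_le ⟨topologicalAddGroup_induced L, continuousSMul_induced L,
    LocallyConvexSpace.induced (L.restrictScalars ℝ), fun p hp => continuous_induced_rng.2 (h p hp)⟩

/-! ### Evaluations and translations on `H_ub` -/

/-- Evaluation at `x`, as a continuous linear functional on `H_ub(E)`. -/
def hubEval (x : E) : Hub E →L[ℂ] ℂ where
  toFun f := (f : E → ℂ) x
  map_add' _ _ := rfl
  map_smul' _ _ := rfl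
  cont := continuous_of_comp_pullback
    { toFun := fun f => (f : E → ℂ) x
      map_add' := fun _ _ => rfl
      map_smul' := fun _ _ => rfl }
    fun p _ => continuous_hb_eval (toQuot p x)

theorem translate_pullback (p : Seminorm ℂ E) (hp : Continuous p) (a : E) (g : Hb (Quot p)) :
    translate a (pullback p hp g : E → ℂ) =
      (pullback p hp (hbTranslate (toQuot p a) g) : E → ℂ) := by
  funext x
  exact congrArg (g : Quot p → ℂ) (map_sub (toQuot p) x a)

theorem IsUniformBoundedType.translate {f : E → ℂ} (hf : IsUniformBoundedType f) (a : E) :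
    IsUniformBoundedType (translate a f) := by
  obtain ⟨p, hp, g, rfl⟩ := hf
  exact ⟨p, hp, hbTranslate (toQuot p a) g, translate_pullback p hp a g⟩

/-- Translation by `a` as a continuous linear operator on `H_ub(E)`. -/
def hubTranslate (a : E) : Hub E →L[ℂ] Hub E where
  toFun f := ⟨translate a (f : E → ℂ), IsUniformBoundedType.translate f.2 a⟩
  map_add' _ _ := rfl
  map_smul' _ _ := rfl
  cont := by
    refine continuous_of_comp_pullback (F := Hub E)
      { toFun := fun f => ⟨translate a (f : E → ℂ), IsUniformBoundedType.translate f.2 a⟩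
        map_add' := fun _ _ => rfl
        map_smul' := fun _ _ => rfl } fun p hp => ?_
    refine ((continuous_pullback p hp).comp (continuous_hbTranslate (toQuot p a))).congr fun g => ?_
    exact Subtype.ext (translate_pullback p hp a g).symm

theorem isConvolutionOperator_hubTranslate (a : E) : IsConvolutionOperator (hubTranslate a) := by
  refine fun f b => ⟨IsUniformBoundedType.translate f.2 b, ?_⟩
  funext x
  exact congrArg (f : E → ℂ) (sub_right_comm x a b)

theorem hubTranslate_iterate_apply (a : E) (f : Hub E) (n : ℕ) (x : E) :
    (((hubTranslate a)^[n] f : Hub E) : E → ℂ) x = (f : E → ℂ) (x - n • a) := by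
  induction n generalizing x with
  | zero => simp
  | succ n ih =>
    rw [Function.iterate_succ_apply']
    refine (ih (x - a)).trans (congrArg (f : E → ℂ) ?_)
    rw [succ_nsmul']
    abel

theorem isUniformBoundedType_continuousLinearMap (φ : E →L[ℂ] ℂ) : IsUniformBoundedType φ := by
  let p : Seminorm ℂ E := (normSeminorm ℂ ℂ).comp φ.toLinearMap
  have hp : Continuous p := φ.continuous.norm
  let S : Seminormed p →ₗ[ℂ] ℂ :=
    { toFun := fun x => φ x
      map_add' := fun x y => map_add φ x y
      map_smul' := fun c x => map_smul φ c x }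
  let S' : Seminormed p →L[ℂ] ℂ := S.mkContinuous 1 fun x => (one_mul ‖x‖).ge
  let ψ : Quot p →L[ℂ] ℂ :=
    SeparationQuotient.liftCLM S' fun x y hxy => (hxy.map S'.continuous).eq
  exact ⟨p, hp, ⟨ψ, isBoundedType_continuousLinearMap ψ⟩, rfl⟩

/-- A function factoring through `π_p` is invariant under the vectors that `p` kills. -/
theorem pullback_add_of_seminorm_eq_zero (p : Seminorm ℂ E) (hp : Continuous p) (g : Hb (Quot p))
    (x : E) {v : E} (hv : p v = 0) :
    (pullback p hp g : E → ℂ) (v + x) = (pullback p hp g : E → ℂ) x := by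
  have h : toQuot p (v + x) = toQuot p x := by
    rw [map_add, norm_eq_zero.1 ((norm_toQuot p v).trans hv), zero_add]
  exact congrArg (g : Quot p → ℂ) h

end LocallyConvex

/-! ### Translations of `H_ub(ℂ^ℕ)` are not hypercyclic -/

theorem exists_seminorm_single_eq_zero (p : Seminorm ℂ (ℕ → ℂ)) (hp : Continuous p) :
    ∃ i, p (Pi.single i 1) = 0 := by
  have hU : {x : ℕ → ℂ | p x < 1} ∈ 𝓝 (0 : ℕ → ℂ) :=
    (isOpen_lt hp continuous_const).mem_nhds (by simp)
  rw [nhds_pi, Filter.mem_pi] at hU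
  obtain ⟨I, hI, t, ht, hIt⟩ := hU
  obtain ⟨i, hi⟩ := hI.exists_notMem
  refine ⟨i, ?_⟩
  have hlt : ∀ c : ℂ, ‖c‖ * p (Pi.single i 1) < 1 := fun c => by
    rw [← map_smul_eq_mul]
    refine hIt fun j hj => ?_
    have hji : j ≠ i := fun h => hi (h ▸ hj)
    simpa [hji] using mem_of_mem_nhds (ht j)
  by_contra h0
  have h := hlt ((p (Pi.single i 1) : ℂ))⁻¹
  rw [norm_inv, Complex.norm_of_nonneg (apply_nonneg p _), inv_mul_cancel₀ h0] at h
  exact lt_irrefl _ h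

theorem not_isHypercyclic_hubTranslate (a : ℕ → ℂ) : ¬ IsHypercyclic (hubTranslate a) := by
  rintro ⟨⟨f, p, hp, g, rfl⟩, hdense⟩
  obtain ⟨i, hi⟩ := exists_seminorm_single_eq_zero p hp
  let φ : Hub (ℕ → ℂ) →L[ℂ] ℂ := hubEval (Pi.single i 1) - hubEval 0
  have horbit : Set.range (fun n : ℕ => (hubTranslate a)^[n] (pullback p hp g)) ⊆ {h | φ h = 0} := by
    rintro _ ⟨n, rfl⟩
    refine sub_eq_zero.2 ?_
    refine (hubTranslate_iterate_apply a _ n _).trans (Eq.trans ?_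
      (hubTranslate_iterate_apply a _ n _).symm)
    rw [sub_eq_add_neg, zero_sub]
    exact pullback_add_of_seminorm_eq_zero p hp g _ hi
  let z : Hub (ℕ → ℂ) := ⟨_, isUniformBoundedType_continuousLinearMap
    (ContinuousLinearMap.proj (R := ℂ) (φ := fun _ : ℕ => ℂ) i)⟩
  have hz : φ z = 0 :=
    closure_minimal horbit (isClosed_eq φ.continuous continuous_const) (hdense z)
  have hz' : φ z = (Pi.single i (1 : ℂ) : ℕ → ℂ) i - (0 : ℕ → ℂ) i := rfl
  rw [hz] at hz'
  simp at hz'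

end BoundedType

end

theorem mainTheorem6 (a : ℕ → ℂ) :
    ∃ T : BoundedType.Hub (ℕ → ℂ) →L[ℂ] BoundedType.Hub (ℕ → ℂ),
      (∀ f : BoundedType.Hub (ℕ → ℂ),
        (T f : (ℕ → ℂ) → ℂ) = BoundedType.translate a (f : (ℕ → ℂ) → ℂ)) ∧
      BoundedType.IsConvolutionOperator T ∧ ¬ BoundedType.IsHypercyclic T :=
  ⟨BoundedType.hubTranslate a, fun _ => rfl, BoundedType.isConvolutionOperator_hubTranslate a,
    BoundedType.not_isHypercyclic_hubTranslate a⟩
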